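/- For every constant $C'>0$ there is a constant $C>0$, depending only on $C'$, such that the following holds. Let $N,n,d\ge 1$, let $A$ be a stochastic $N\times N$ matrix and let $\mu$ be a probability vector on $[N]=\{1,\dots,N\}$ with $\mu_iA_{ij}=\mu_jA_{ji}$ for all $i,j$. Let $Y_1,Y_2,\dots$ be the (stationary, reversible) Markov chain on $[N]$ with transition matrix $A$ and $Y_1$ distributed according to $\mu$. Let $(E_\mu)_{ij}=\mu_j$, let $\|v\|_{L_2(\mu)}^2=\sum_i|v_i|^2\mu_i$ for $v\in\mathbb R^N$, and put $$\lambda=\|A-E_\mu\|_{L_2(\mu)\to L_2(\mu)}=\max_{\|v\|_{L_2(\mu)}=1}\|(A-E_\mu)v\|_{L_2(\mu)};$$ assume $\lambda<1$. Let $f_1,\dots,f_n:[N]\to\{-1,1\}$ satisfy $\mathbb E[f_i(Y_i)]=0$ for every $i$. Then for all $v_1,\dots,v_n\in\mathbb R^d$ of Euclidean length at least $1$, every $x_0\in\mathbb R^d$ and every $R\ge \frac{1}{C'\sqrt d}$, $$\Pr\bigl[\|f_1(Y_1)v_1+\cdots+f_n(Y_n)v_n-x_0\|_{\ell_2}\le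 R\bigr]\le\frac{C\,R\sqrt d}{(1-\lambda)\sqrt n}.$$ -/

import Mathlib

open MeasureTheory

/-- The `L₂(μ)` norm on `ℝ^N`: `‖v‖² = ∑ i, |v i|² μ i`. -/
noncomputable def l2Norm {N : ℕ} (μ v : Fin N → ℝ) : ℝ :=
  √(∑ i, |v i| ^ 2 * μ i)

/-- The operator norm `L₂(μ) → L₂(μ)` of a matrix: the largest value of `‖B v‖` over all `v` with
`‖v‖ = 1`. -/
noncomputable def l2OpNorm {N : ℕ} (μ : Fin N → ℝ) (B : Matrix (Fin N) (Fin N) ℝ) : ℝ :=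
  sSup {r : ℝ | ∃ v : Fin N → ℝ, l2Norm μ v = 1 ∧ r = l2Norm μ (B.mulVec v)}

/-- The averaging operator `E_μ`, with entries `(E_μ) i j = μ j`. -/
def averagingOp {N : ℕ} (μ : Fin N → ℝ) : Matrix (Fin N) (Fin N) ℝ :=
  Matrix.of fun _ j => μ j

/-- `Y 0, Y 1, …` is a stationary reversible Markov chain on `Fin N` with transition matrix `A` and
stationary distribution `μ`, defined on the probability space `(Ω, P)`. -/
structure IsStationaryReversibleChain {Ω : Type*} [MeasurableSpace Ω] (P : Measure Ω) {N : ℕ}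
    (A : Matrix (Fin N) (Fin N) ℝ) (μ : Fin N → ℝ) (Y : ℕ → Ω → Fin N) : Prop where
  /-- The entries of `A` are nonnegative and each row sums to one. -/
  stochastic : A ∈ Matrix.rowStochastic ℝ (Fin N)
  /-- `μ` is a probability vector. -/
  prob : μ ∈ stdSimplex ℝ (Fin N)
  /-- Detailed balance; summing over `i` shows that `μ` is stationary for `A`. -/
  reversible : ∀ i j, μ i * A i j = μ j * A j i
  measurable : ∀ k, Measurable (Y k)
  /-- The initial state has law `μ`. -/
  initial : ∀ y, P.real {ω | Y 0 ω = y} = μ y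
  /-- The Markov property: given the path `y 0, …, y k` up to time `k`, the next state is `z` with
  conditional probability `A (y k) z`. -/
  markov : ∀ (k : ℕ) (y : ℕ → Fin N) (z : Fin N),
    P.real {ω | (∀ i ≤ k, Y i ω = y i) ∧ Y (k + 1) ω = z} =
      P.real {ω | ∀ i ≤ k, Y i ω = y i} * A (y k) z

/-! Projecting onto a sign vector `ε` reduces the theorem to dimension one. By Paley–Zygmund, `|⟨ε,
v i⟩| ≥ 1/√2` for at least 1/16 of all `ε`, so by averaging one `ε` serves at least `n / 16` indices
(`exists_sign_vector`). Since `ε` has length `√d`, the ball of radius `R` projects into an interval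
of half-length `r = √d * R`.

On the line, Esseen's inequality bounds the probability by an integral of the characteristic
function. Integrating out the chain from its last step backwards turns that function into an
iteration of `h ↦ exp(iθf) · A h`. Applying `A` keeps the mean and shrinks the variance; multiplying
by the phase keeps the second moment but, as `f` is centred, turns the mean towards a covariance
with `f`. Hence |mean|² + `lam` · variance drops by the factor `1 - (1 - lam) sin²θ / 4`
(`potential_step_le`), and the characteristic function is at most `exp(-(1 - lam)/8 · ∑ sin²(t a
i))` (`norm_charFun_le`). Jensen's inequality separates the frequencies, and each resulting integral
is of Gaussian size. -/

section L2
-- Variance contraction in `L₂(μ)`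
variable {N : ℕ} {A : Matrix (Fin N) (Fin N) ℝ} {μ : Fin N → ℝ}

/-- Detailed balance makes `μ` stationary. -/
theorem sum_mul_mulVec_of_reversible (hA : A ∈ Matrix.rowStochastic ℝ (Fin N))
    (hrev : ∀ i j, μ i * A i j = μ j * A j i) (u : Fin N → ℝ) :
    ∑ i, μ i * (A.mulVec u) i = ∑ i, μ i * u i := by
  simp only [Matrix.mulVec, dotProduct, Finset.mul_sum]
  rw [Finset.sum_comm]
  refine Finset.sum_congr rfl fun j _ => ?_
  have : ∀ i, μ i * (A i j * u j) = μ j * u j * A j i := fun i => by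
    rw [← mul_assoc, hrev]; ring
  simp only [this]
  rw [← Finset.mul_sum, Matrix.sum_row_of_mem_rowStochastic hA, mul_one]

theorem sq_mulVec_le_of_rowStochastic (hA : A ∈ Matrix.rowStochastic ℝ (Fin N))
    (u : Fin N → ℝ) (i : Fin N) :
    (A.mulVec u i) ^ 2 ≤ A.mulVec (fun j => u j ^ 2) i := by
  have := Finset.sum_mul_sq_le_sq_mul_sq Finset.univ (fun j => √(A i j))
    (fun j => √(A i j) * u j)
  have hn : ∀ j, 0 ≤ A i j := fun j => Matrix.nonneg_of_mem_rowStochastic hA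
  simp only [mul_pow, ← mul_assoc, Real.mul_self_sqrt (hn _), Real.sq_sqrt (hn _),
    Matrix.sum_row_of_mem_rowStochastic hA, one_mul] at this
  exact this

theorem l2Norm_sq (hμ : ∀ i, 0 ≤ μ i) (u : Fin N → ℝ) :
    l2Norm μ u ^ 2 = ∑ i, μ i * u i ^ 2 := by
  rw [l2Norm, Real.sq_sqrt (Finset.sum_nonneg fun i _ => mul_nonneg (by positivity) (hμ i))]
  exact Finset.sum_congr rfl fun i _ => by rw [sq_abs, mul_comm]

theorem l2Norm_nonneg (u : Fin N → ℝ) : 0 ≤ l2Norm μ u := Real.sqrt_nonneg _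

theorem l2Norm_smul (c : ℝ) (u : Fin N → ℝ) : l2Norm μ (c • u) = |c| * l2Norm μ u := by
  rw [l2Norm, l2Norm, ← Real.sqrt_sq_eq_abs, ← Real.sqrt_mul (sq_nonneg c), Finset.mul_sum]
  congr 1
  refine Finset.sum_congr rfl fun i _ => ?_
  simp only [Pi.smul_apply, smul_eq_mul, abs_mul, mul_pow, sq_abs]; ring

theorem averagingOp_mulVec (u : Fin N → ℝ) (i : Fin N) :
    (averagingOp μ).mulVec u i = ∑ j, μ j * u j := by
  simp [averagingOp, Matrix.mulVec, dotProduct]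

/-- The second moment about the mean. -/
theorem sum_mul_sub_sq (hμ : ∑ i, μ i = 1) (u : Fin N → ℝ) (m : ℝ) (hm : ∑ i, μ i * u i = m) :
    ∑ i, μ i * (u i - m) ^ 2 = ∑ i, μ i * u i ^ 2 - m ^ 2 := by
  have : ∀ i, μ i * (u i - m) ^ 2 = μ i * u i ^ 2 - 2 * m * (μ i * u i) + m ^ 2 * μ i :=
    fun i => by ring
  simp only [this, Finset.sum_add_distrib, Finset.sum_sub_distrib, ← Finset.mul_sum, hμ, hm]
  ring

/-- Row-wise Jensen and stationarity. This bounds the set in `l2OpNorm`, so that its `sSup` is a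
genuine supremum; it also covers vectors of norm zero, which cannot be normalised. -/
theorem l2Norm_sub_averagingOp_mulVec_le (hA : A ∈ Matrix.rowStochastic ℝ (Fin N))
    (hμ : μ ∈ stdSimplex ℝ (Fin N)) (hrev : ∀ i j, μ i * A i j = μ j * A j i)
    (u : Fin N → ℝ) : l2Norm μ ((A - averagingOp μ).mulVec u) ≤ l2Norm μ u := by
  refine (sq_le_sq₀ (l2Norm_nonneg _) (l2Norm_nonneg _)).1 ?_
  rw [l2Norm_sq hμ.1, l2Norm_sq hμ.1]
  simp only [Matrix.sub_mulVec, Pi.sub_apply, averagingOp_mulVec]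
  rw [sum_mul_sub_sq hμ.2 _ _ (sum_mul_mulVec_of_reversible hA hrev u)]
  rw [← sum_mul_mulVec_of_reversible hA hrev (fun j => u j ^ 2)]
  have : ∑ i, μ i * (A.mulVec u i) ^ 2 ≤ ∑ i, μ i * A.mulVec (fun j => u j ^ 2) i :=
    Finset.sum_le_sum fun i _ =>
      mul_le_mul_of_nonneg_left (sq_mulVec_le_of_rowStochastic hA u i) (hμ.1 i)
  nlinarith [sq_nonneg (∑ i, μ i * u i)]

theorem l2OpNorm_nonneg (B : Matrix (Fin N) (Fin N) ℝ) : 0 ≤ l2OpNorm μ B := by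
  refine Real.sSup_nonneg ?_
  rintro r ⟨v, -, rfl⟩
  exact l2Norm_nonneg _

theorem l2Norm_sub_averagingOp_mulVec_le_l2OpNorm (hA : A ∈ Matrix.rowStochastic ℝ (Fin N))
    (hμ : μ ∈ stdSimplex ℝ (Fin N)) (hrev : ∀ i j, μ i * A i j = μ j * A j i)
    (u : Fin N → ℝ) :
    l2Norm μ ((A - averagingOp μ).mulVec u) ≤
      l2OpNorm μ (A - averagingOp μ) * l2Norm μ u := by
  rcases (l2Norm_nonneg (μ := μ) u).eq_or_lt with h0 | hpos
  · have := l2Norm_sub_averagingOp_mulVec_le hA hμ hrev u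
    rw [← h0] at this ⊢
    simpa using this
  · have hb : BddAbove {r : ℝ | ∃ v : Fin N → ℝ, l2Norm μ v = 1 ∧
        r = l2Norm μ ((A - averagingOp μ).mulVec v)} := by
      refine ⟨1, ?_⟩
      rintro r ⟨v, hv, rfl⟩
      exact hv ▸ l2Norm_sub_averagingOp_mulVec_le hA hμ hrev v
    have := le_csSup hb ⟨(l2Norm μ u)⁻¹ • u, by
      rw [l2Norm_smul, abs_of_pos (inv_pos.2 hpos), inv_mul_cancel₀ hpos.ne'], rfl⟩
    rw [Matrix.mulVec_smul, l2Norm_smul, abs_of_pos (inv_pos.2 hpos),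
      inv_mul_le_iff₀ hpos] at this
    rw [mul_comm]
    exact this

/-- A step of the chain contracts the variance by the square of the operator norm. -/
theorem variance_mulVec_le (hA : A ∈ Matrix.rowStochastic ℝ (Fin N))
    (hμ : μ ∈ stdSimplex ℝ (Fin N)) (hrev : ∀ i j, μ i * A i j = μ j * A j i)
    (u : Fin N → ℝ) :
    ∑ i, μ i * (A.mulVec u i) ^ 2 - (∑ i, μ i * u i) ^ 2 ≤
      l2OpNorm μ (A - averagingOp μ) ^ 2 * (∑ i, μ i * u i ^ 2 - (∑ i, μ i * u i) ^ 2) := by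
  set m := ∑ i, μ i * u i with hm
  -- `averagingOp μ` kills the centred vector `u - m` and `A` fixes constants, so the image is `A u
  -- - m`.
  have h := l2Norm_sub_averagingOp_mulVec_le_l2OpNorm hA hμ hrev (fun i => u i - m)
  have h2 := pow_le_pow_left₀ (l2Norm_nonneg _) h 2
  rw [mul_pow, l2Norm_sq hμ.1, l2Norm_sq hμ.1, sum_mul_sub_sq hμ.2 u m hm.symm] at h2
  rw [← sum_mul_sub_sq hμ.2 _ m ((sum_mul_mulVec_of_reversible hA hrev u).trans hm.symm)]
  refine le_trans (le_of_eq (Finset.sum_congr rfl fun i _ => ?_)) h2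
  congr 2
  rw [Matrix.sub_mulVec, Pi.sub_apply, averagingOp_mulVec]
  have h1 : ∑ j, μ j * (u j - m) = 0 := by
    simp only [mul_sub, Finset.sum_sub_distrib, ← Finset.sum_mul, hμ.2]
    rw [← hm]; ring
  rw [h1, sub_zero]
  simp only [Matrix.mulVec, dotProduct, mul_sub, Finset.sum_sub_distrib, ← Finset.sum_mul,
    Matrix.sum_row_of_mem_rowStochastic hA, one_mul]

/-! ### Complex observables and the Lyapunov function -/

/-- Transition operator on complex-valued functions. -/
noncomputable def transition (A : Matrix (Fin N) (Fin N) ℝ) (h : Fin N → ℂ) (i : Fin N) : ℂ :=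
  ∑ j, (A i j : ℂ) * h j

/-- Mean of a complex-valued function. -/
noncomputable def cmean (μ : Fin N → ℝ) (h : Fin N → ℂ) : ℂ := ∑ i, (μ i : ℂ) * h i

/-- Second moment of a complex-valued function. -/
noncomputable def moment₂ (μ : Fin N → ℝ) (h : Fin N → ℂ) : ℝ := ∑ i, μ i * ‖h i‖ ^ 2

theorem transition_re (h : Fin N → ℂ) (i : Fin N) :
    (transition A h i).re = A.mulVec (fun j => (h j).re) i := by
  simp [transition, Matrix.mulVec, dotProduct]

theorem transition_im (h : Fin N → ℂ) (i : Fin N) :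
    (transition A h i).im = A.mulVec (fun j => (h j).im) i := by
  simp [transition, Matrix.mulVec, dotProduct]

theorem cmean_re (h : Fin N → ℂ) : (cmean μ h).re = ∑ i, μ i * (h i).re := by
  simp [cmean]

theorem cmean_im (h : Fin N → ℂ) : (cmean μ h).im = ∑ i, μ i * (h i).im := by
  simp [cmean]

theorem moment₂_eq (h : Fin N → ℂ) :
    moment₂ μ h = ∑ i, μ i * (h i).re ^ 2 + ∑ i, μ i * (h i).im ^ 2 := by
  rw [moment₂, ← Finset.sum_add_distrib]
  refine Finset.sum_congr rfl fun i _ => ?_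
  rw [Complex.sq_norm, Complex.normSq_apply]; ring

theorem cmean_transition (hA : A ∈ Matrix.rowStochastic ℝ (Fin N))
    (hrev : ∀ i j, μ i * A i j = μ j * A j i) (h : Fin N → ℂ) :
    cmean μ (transition A h) = cmean μ h := by
  apply Complex.ext
  · simp only [cmean_re, transition_re, sum_mul_mulVec_of_reversible hA hrev]
  · simp only [cmean_im, transition_im, sum_mul_mulVec_of_reversible hA hrev]

theorem transition_variance_le (hA : A ∈ Matrix.rowStochastic ℝ (Fin N))
    (hμ : μ ∈ stdSimplex ℝ (Fin N)) (hrev : ∀ i j, μ i * A i j = μ j * A j i)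
    (h : Fin N → ℂ) :
    moment₂ μ (transition A h) - ‖cmean μ h‖ ^ 2 ≤
      l2OpNorm μ (A - averagingOp μ) ^ 2 * (moment₂ μ h - ‖cmean μ h‖ ^ 2) := by
  have h1 := variance_mulVec_le hA hμ hrev (fun i => (h i).re)
  have h2 := variance_mulVec_le hA hμ hrev (fun i => (h i).im)
  simp only [moment₂_eq, transition_re, transition_im, Complex.sq_norm, Complex.normSq_apply,
    cmean_re, cmean_im]
  linarith

/-- Cauchy–Schwarz for the covariance with a centred function of modulus at most one. -/
theorem norm_cmean_mul_sq_le (hμ : μ ∈ stdSimplex ℝ (Fin N)) (h : Fin N → ℂ) (f : Fin N → ℝ)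
    (hf : ∀ i, f i ^ 2 ≤ 1) (hf0 : ∑ i, μ i * f i = 0) :
    ‖cmean μ (fun i => f i * h i)‖ ^ 2 ≤ moment₂ μ h - ‖cmean μ h‖ ^ 2 := by
  have key : ∀ u : Fin N → ℝ, (∑ i, μ i * (f i * u i)) ^ 2 ≤
      ∑ i, μ i * u i ^ 2 - (∑ i, μ i * u i) ^ 2 := by
    intro u
    rw [← sum_mul_sub_sq hμ.2 u _ rfl]
    set m := ∑ i, μ i * u i
    -- As `f` has mean zero, `u` may be centred before Cauchy–Schwarz.
    have e : ∑ i, μ i * (f i * u i) = ∑ i, √(μ i) * f i * (√(μ i) * (u i - m)) := by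
      have : ∀ i, √(μ i) * f i * (√(μ i) * (u i - m)) =
          μ i * (f i * u i) - μ i * f i * m := fun i => by
        linear_combination (f i * (u i - m)) * Real.mul_self_sqrt (hμ.1 i)
      simp only [this, Finset.sum_sub_distrib, ← Finset.sum_mul, hf0]
      ring
    rw [e]
    refine (Finset.sum_mul_sq_le_sq_mul_sq _ _ _).trans ?_
    simp only [mul_pow, Real.sq_sqrt (hμ.1 _)]
    refine mul_le_of_le_one_left
      (Finset.sum_nonneg fun i _ => mul_nonneg (hμ.1 i) (sq_nonneg _)) ?_
    exact (Finset.sum_le_sum fun i _ => mul_le_of_le_one_right (hμ.1 i) (hf i)).trans hμ.2.le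
  have h1 := key (fun i => (h i).re)
  have h2 := key (fun i => (h i).im)
  simp only [moment₂_eq, Complex.sq_norm, Complex.normSq_apply, cmean_re, cmean_im,
    Complex.re_ofReal_mul, Complex.im_ofReal_mul]
  linarith

/-- Lyapunov function: the squared mean plus `lam` times the variance. -/
noncomputable def potential (lam : ℝ) (μ : Fin N → ℝ) (h : Fin N → ℂ) : ℝ :=
  lam * moment₂ μ h + (1 - lam) * ‖cmean μ h‖ ^ 2

theorem norm_cmean_sq_le_moment₂ (hμ : μ ∈ stdSimplex ℝ (Fin N)) (h : Fin N → ℂ) :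
    ‖cmean μ h‖ ^ 2 ≤ moment₂ μ h := by
  have := norm_cmean_mul_sq_le hμ h 0 (by simp) (by simp)
  nlinarith [sq_nonneg ‖cmean μ (fun i => ((0 : Fin N → ℝ) i : ℂ) * h i)‖]

theorem norm_cmean_sq_le_potential {lam : ℝ} (h0 : 0 ≤ lam) (hμ : μ ∈ stdSimplex ℝ (Fin N))
    (h : Fin N → ℂ) : ‖cmean μ h‖ ^ 2 ≤ potential lam μ h := by
  have := norm_cmean_sq_le_moment₂ hμ h
  unfold potential
  nlinarith

/-- Here `a` is the modulus of the mean, `V` the old variance, `b` the standard deviation after `A`,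
and `c`, `s` are |cos θ|, |sin θ|. The loss is at least `(1 - lam) * (lam * V + (s * a - c * b) ^
2)`: if the second term is small, then `s * a` is close to `c * b`, which `lam * V` controls. -/
theorem quadratic_contraction {lam a b V c s : ℝ} (h0 : 0 ≤ lam) (h1 : lam ≤ 1)
    (hV : 0 ≤ V) (hb : b ^ 2 ≤ lam ^ 2 * V) (hcs : c ^ 2 + s ^ 2 = 1) :
    lam * (a ^ 2 + b ^ 2) + (1 - lam) * (c * a + s * b) ^ 2 ≤
      (1 - (1 - lam) * s ^ 2 / 4) * (a ^ 2 + lam * V) := by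
  have e1 : (c * a + s * b) ^ 2 = a ^ 2 + b ^ 2 - (s * a - c * b) ^ 2 := by
    linear_combination (a ^ 2 + b ^ 2) * hcs
  have hs : s ^ 2 ≤ 1 := by nlinarith [sq_nonneg c]
  have hc : c ^ 2 ≤ 1 := by nlinarith [sq_nonneg s]
  have hlV : 0 ≤ lam * V := mul_nonneg h0 hV
  have hb' : b ^ 2 ≤ lam * V := by nlinarith
  have e2 : s ^ 2 * a ^ 2 ≤ 2 * (s * a - c * b) ^ 2 + 2 * (lam * V) := by
    have : c ^ 2 * b ^ 2 ≤ lam * V := (mul_le_of_le_one_left (sq_nonneg b) hc).trans hb'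
    nlinarith [sq_nonneg (s * a - 2 * (c * b))]
  have e3 : s ^ 2 / 4 * (a ^ 2 + lam * V) ≤ lam * V + (s * a - c * b) ^ 2 := by
    have : s ^ 2 * (lam * V) ≤ lam * V := mul_le_of_le_one_left hlV hs
    nlinarith [sq_nonneg (s * a - c * b)]
  have e4 := mul_le_mul_of_nonneg_left e3 (sub_nonneg.2 h1)
  rw [e1]
  nlinarith

theorem potential_step_le (hA : A ∈ Matrix.rowStochastic ℝ (Fin N))
    (hμ : μ ∈ stdSimplex ℝ (Fin N)) (hrev : ∀ i j, μ i * A i j = μ j * A j i)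
    {lam : ℝ} (hlam : lam = l2OpNorm μ (A - averagingOp μ)) (h1 : lam ≤ 1)
    (f : Fin N → ℝ) (hf : ∀ i, f i = -1 ∨ f i = 1) (hf0 : ∑ i, μ i * f i = 0) (θ : ℝ)
    (h : Fin N → ℂ) :
    potential lam μ (fun i => Complex.exp (↑(θ * f i) * Complex.I) * transition A h i) ≤
      (1 - (1 - lam) * Real.sin θ ^ 2 / 4) * potential lam μ h := by
  have h0 : 0 ≤ lam := hlam ▸ l2OpNorm_nonneg _
  set k := transition A h with hk
  have hm : cmean μ k = cmean μ h := cmean_transition hA hrev h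
  have hvar := transition_variance_le hA hμ hrev h
  rw [← hlam, ← hk] at hvar
  have hcov := norm_cmean_mul_sq_le hμ k f (fun i => by rcases hf i with h | h <;> simp [h]) hf0
  rw [hm] at hcov
  set q := cmean μ (fun i => f i * k i) with hq
  have hM : moment₂ μ (fun i => Complex.exp (↑(θ * f i) * Complex.I) * k i) = moment₂ μ k := by
    simp only [moment₂, norm_mul, Complex.norm_exp_ofReal_mul_I, one_mul]
  -- For `f i = ±1` the phase is affine in `f i`, so the new mean involves only the old mean and the
  -- covariance `q`.
  have hexp : ∀ i, Complex.exp (↑(θ * f i) * Complex.I) =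
      Real.cos θ + Real.sin θ * Complex.I * f i := by
    intro i
    rw [Complex.exp_mul_I, ← Complex.ofReal_cos, ← Complex.ofReal_sin]
    rcases hf i with h | h <;> simp [h]
  have hβ : cmean μ (fun i => Complex.exp (↑(θ * f i) * Complex.I) * k i) =
      Real.cos θ * cmean μ h + Real.sin θ * Complex.I * q := by
    rw [← hm, hq]
    simp only [cmean, hexp, Finset.mul_sum, ← Finset.sum_add_distrib]
    exact Finset.sum_congr rfl fun i _ => by ring
  set b := √(moment₂ μ k - ‖cmean μ h‖ ^ 2) with hbdef
  have hvk : 0 ≤ moment₂ μ k - ‖cmean μ h‖ ^ 2 := by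
    rw [← hm]; exact sub_nonneg.2 (norm_cmean_sq_le_moment₂ hμ k)
  have hb2 : b ^ 2 = moment₂ μ k - ‖cmean μ h‖ ^ 2 := Real.sq_sqrt hvk
  have hqb : ‖q‖ ≤ b := Real.le_sqrt_of_sq_le hcov
  have hβ2 : ‖cmean μ (fun i => Complex.exp (↑(θ * f i) * Complex.I) * k i)‖ ≤
      |Real.cos θ| * ‖cmean μ h‖ + |Real.sin θ| * b := by
    rw [hβ]
    refine (norm_add_le _ _).trans ?_
    simp only [norm_mul, Complex.norm_real, Complex.norm_I, mul_one, Real.norm_eq_abs]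
    gcongr
  have hmain := quadratic_contraction (a := ‖cmean μ h‖) (b := b)
    (V := moment₂ μ h - ‖cmean μ h‖ ^ 2) (c := |Real.cos θ|) (s := |Real.sin θ|) h0 h1
    (sub_nonneg.2 (norm_cmean_sq_le_moment₂ hμ h)) (hb2.trans_le hvar)
    (by rw [sq_abs, sq_abs]; exact Real.cos_sq_add_sin_sq θ)
  have hsq := pow_le_pow_left₀ (norm_nonneg _) hβ2 2
  have hsq' := mul_le_mul_of_nonneg_left hsq (sub_nonneg.2 h1)
  rw [sq_abs] at hmain
  calc _ = lam * (‖cmean μ h‖ ^ 2 + b ^ 2) + (1 - lam) *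
        ‖cmean μ (fun i => Complex.exp (↑(θ * f i) * Complex.I) * k i)‖ ^ 2 := by
        rw [potential, hM, hb2]; ring
    _ ≤ _ := (add_le_add_right hsq' _).trans hmain
    _ = _ := by rw [potential]; ring

end L2

/-! ### Markov property and characteristic function -/

theorem integral_comp_eq_sum {Ω β : Type*} [MeasurableSpace Ω] (P : Measure Ω)
    [IsProbabilityMeasure P] [Fintype β] [MeasurableSpace β] [MeasurableSingletonClass β]
    {Z : Ω → β} (hZ : Measurable Z) (F : β → ℂ) :
    ∫ ω, F (Z ω) ∂P = ∑ b, (P.real {ω | Z ω = b} : ℂ) * F b := by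
  have := Measure.isProbabilityMeasure_map (μ := P) hZ.aemeasurable
  have hF : Measurable F := measurable_of_finite F
  rw [← integral_map hZ.aemeasurable hF.aestronglyMeasurable,
    integral_fintype (Integrable.of_finite)]
  refine Finset.sum_congr rfl fun b _ => ?_
  rw [map_measureReal_apply hZ (measurableSet_singleton b), Complex.real_smul]
  rfl

namespace IsStationaryReversibleChain

variable {Ω : Type*} [MeasurableSpace Ω] {P : Measure Ω} [IsProbabilityMeasure P] {N : ℕ}
  {A : Matrix (Fin N) (Fin N) ℝ} {μ : Fin N → ℝ} {Y : ℕ → Ω → Fin N}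

theorem integral_initial (H : IsStationaryReversibleChain P A μ Y) (h : Fin N → ℂ) :
    ∫ ω, h (Y 0 ω) ∂P = cmean μ h := by
  rw [integral_comp_eq_sum P (H.measurable 0), cmean]
  simp only [H.initial]

/-- The Markov property for functions of the path. -/
theorem integral_path_mul (H : IsStationaryReversibleChain P A μ Y) (k : ℕ)
    (G : (Fin (k + 1) → Fin N) → ℂ) (h : Fin N → ℂ) :
    ∫ ω, G (fun i => Y i ω) * h (Y (k + 1) ω) ∂P =
      ∫ ω, G (fun i => Y i ω) * transition A h (Y k ω) ∂P := by
  have hZ : Measurable fun ω => fun i : Fin (k + 1) => Y i ω :=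
    measurable_pi_lambda _ fun i => H.measurable i
  -- `markov` expects an infinite path; clamping the index at `k` extends `p` without affecting
  -- times up to `k`.
  have hpath : ∀ p : Fin (k + 1) → Fin N, ∀ ω,
      (∀ i ≤ k, Y i ω = p ⟨min i k, by omega⟩) ↔ (fun i : Fin (k + 1) => Y i ω) = p := by
    intro p ω
    rw [funext_iff]
    constructor
    · intro h i
      rw [h i (by omega)]
      congr 1
      ext
      simp only [inf_eq_left]
      omega
    · intro h i hi
      refine (h ⟨i, by omega⟩).trans ?_
      congr 1
      ext
      exact (min_eq_left hi).symm
  have hlaw : ∀ p : Fin (k + 1) → Fin N, ∀ z,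
      P.real {ω | (fun i : Fin (k + 1) => Y i ω, Y (k + 1) ω) = (p, z)} =
        P.real {ω | (fun i : Fin (k + 1) => Y i ω) = p} * A (p (Fin.last k)) z := by
    intro p z
    have := H.markov k (fun i => p ⟨min i k, by omega⟩) z
    simp only [hpath] at this
    simp only [Prod.mk.injEq, this, min_self]
    rfl
  have e1 := integral_comp_eq_sum P (hZ.prodMk (H.measurable (k + 1)))
    fun q => G q.1 * h q.2
  have e2 := integral_comp_eq_sum P hZ fun p => G p * transition A h (p (Fin.last k))
  simp only [Fin.val_last] at e2
  rw [e1, e2, Fintype.sum_prod_type]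
  refine Finset.sum_congr rfl fun p _ => ?_
  simp only [hlaw, transition, Finset.mul_sum]
  refine Finset.sum_congr rfl fun z _ => ?_
  push_cast
  ring

/-- Removes the last time and absorbs the last factor into the test function: the backward recursion
behind the characteristic function bound. -/
theorem integral_prod_mul_succ (H : IsStationaryReversibleChain P A μ Y) (g : ℕ → Fin N → ℂ)
    (k : ℕ) (h : Fin N → ℂ) :
    ∫ ω, (∏ j ∈ Finset.range (k + 1), g j (Y j ω)) * h (Y (k + 1) ω) ∂P =
      ∫ ω, (∏ j ∈ Finset.range k, g j (Y j ω)) *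
        (fun y => g k y * transition A h y) (Y k ω) ∂P := by
  have := H.integral_path_mul k (fun p => ∏ j : Fin (k + 1), g j (p j)) h
  have e : ∀ ω, ∏ j : Fin (k + 1), g j (Y j ω) = ∏ j ∈ Finset.range (k + 1), g j (Y j ω) :=
    fun ω => Fin.prod_univ_eq_prod_range (fun j => g j (Y j ω)) (k + 1)
  simp only [e] at this
  rw [this]
  simp only [Finset.prod_range_succ, mul_assoc]

theorem integral_comp (H : IsStationaryReversibleChain P A μ Y) (k : ℕ) (h : Fin N → ℂ) :
    ∫ ω, h (Y k ω) ∂P = cmean μ h := by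
  induction k generalizing h with
  | zero => exact H.integral_initial h
  | succ k ih =>
    have := H.integral_prod_mul_succ (fun _ _ => 1) k h
    simp only [Finset.prod_const_one, one_mul] at this
    rw [this, ih, cmean_transition H.stochastic H.reversible]

theorem sum_mul_eq_integral (H : IsStationaryReversibleChain P A μ Y) (k : ℕ) (f : Fin N → ℝ) :
    ∑ y, μ y * f y = ∫ ω, f (Y k ω) ∂P := by
  have := H.integral_comp k (fun y => (f y : ℂ))
  rw [integral_complex_ofReal, cmean] at this
  exact_mod_cast this.symm

theorem norm_integral_prod_exp_sq_le (H : IsStationaryReversibleChain P A μ Y) {lam : ℝ}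
    (hlam : lam = l2OpNorm μ (A - averagingOp μ)) (h1 : lam ≤ 1) (n : ℕ) (f : ℕ → Fin N → ℝ)
    (hf : ∀ i < n, ∀ y, f i y = -1 ∨ f i y = 1)
    (hf0 : ∀ i < n, ∑ y, μ y * f i y = 0) (θ : ℕ → ℝ) (h : Fin N → ℂ) :
    ‖∫ ω, (∏ j ∈ Finset.range n, Complex.exp (↑(θ j * f j (Y j ω)) * Complex.I)) *
        h (Y n ω) ∂P‖ ^ 2 ≤
      (∏ j ∈ Finset.range n, (1 - (1 - lam) * Real.sin (θ j) ^ 2 / 4)) * potential lam μ h := by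
  have h0 : 0 ≤ lam := hlam ▸ l2OpNorm_nonneg _
  induction n generalizing h with
  | zero =>
    simp only [Finset.range_zero, Finset.prod_empty, one_mul]
    rw [H.integral_initial]
    exact norm_cmean_sq_le_potential h0 H.prob h
  | succ n ih =>
    have e := H.integral_prod_mul_succ
      (fun j y => Complex.exp (↑(θ j * f j y) * Complex.I)) n h
    have hstep := potential_step_le H.stochastic H.prob H.reversible hlam h1 (f n)
      (hf n (Nat.lt_succ_self n)) (hf0 n (Nat.lt_succ_self n)) (θ n) h
    have hih := ih (fun i hi => hf i (Nat.lt_succ_of_lt hi))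
      (fun i hi => hf0 i (Nat.lt_succ_of_lt hi))
      (fun y => Complex.exp (↑(θ n * f n y) * Complex.I) * transition A h y)
    have hnn : 0 ≤ ∏ j ∈ Finset.range n, (1 - (1 - lam) * Real.sin (θ j) ^ 2 / 4) :=
      Finset.prod_nonneg fun j _ => by
        nlinarith [Real.sin_sq_le_one (θ j), sq_nonneg (Real.sin (θ j))]
    rw [e, Finset.prod_range_succ _ n, mul_assoc]
    exact hih.trans (mul_le_mul_of_nonneg_left hstep hnn)

/-- The characteristic function of a weighted sum of signs along the chain. -/
theorem norm_charFun_le (H : IsStationaryReversibleChain P A μ Y) {lam : ℝ}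
    (hlam : lam = l2OpNorm μ (A - averagingOp μ)) (h1 : lam ≤ 1) {n : ℕ} (f : Fin n → Fin N → ℝ)
    (hf : ∀ i y, f i y = -1 ∨ f i y = 1) (hf0 : ∀ i, ∫ ω, f i (Y i ω) ∂P = 0)
    (a : Fin n → ℝ) (c : ℝ) (S : Finset (Fin n)) (t : ℝ) :
    ‖∫ ω, Complex.exp (↑(t * (∑ i, f i (Y i ω) * a i - c)) * Complex.I) ∂P‖ ≤
      Real.exp (-((1 - lam) / 8) * ∑ i ∈ S, Real.sin (t * a i) ^ 2) := by
  -- The value 0 beyond `n` is never used: all products run over `Finset.range n`.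
  set F : ℕ → Fin N → ℝ := fun j => if hj : j < n then f ⟨j, hj⟩ else 0 with hF
  set θ : ℕ → ℝ := fun j => if hj : j < n then t * a ⟨j, hj⟩ else 0 with hθ
  have hFi : ∀ i : Fin n, F i = f i := fun i => by simp [hF]
  have hθi : ∀ i : Fin n, θ i = t * a i := fun i => by simp [hθ]
  have hb := H.norm_integral_prod_exp_sq_le hlam h1 n F
    (fun i hi y => by simpa [hF, hi] using hf ⟨i, hi⟩ y)
    (fun i hi => by
      rw [H.sum_mul_eq_integral i]
      simpa [hF, hi] using hf0 ⟨i, hi⟩) θ (fun _ => 1)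
  have hpot : potential lam μ (fun _ => 1) = 1 := by
    have : cmean μ (fun _ => 1) = 1 := by
      simp only [cmean, mul_one]; exact_mod_cast H.prob.2
    simp [potential, moment₂, this, H.prob.2]
  have hprod : ∀ ω, Complex.exp (↑(t * (∑ i, f i (Y i ω) * a i - c)) * Complex.I) =
      Complex.exp (↑(-(t * c)) * Complex.I) *
        ∏ j ∈ Finset.range n, Complex.exp (↑(θ j * F j (Y j ω)) * Complex.I) := by
    intro ω
    rw [← Complex.exp_sum, ← Complex.exp_add, ← Finset.sum_mul, ← add_mul, ← Complex.ofReal_sum,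
      ← Complex.ofReal_add, ← Fin.sum_univ_eq_sum_range (fun j => θ j * F j (Y j ω))]
    simp only [hFi, hθi]
    congr 3
    rw [mul_sub, Finset.mul_sum]
    rw [sub_eq_neg_add]
    congr 1
    exact Finset.sum_congr rfl fun i _ => by ring
  simp only [hprod]
  rw [integral_const_mul, norm_mul, Complex.norm_exp_ofReal_mul_I, one_mul]
  simp only [mul_one, hpot] at hb
  -- The available bound is on the square, hence 1/8 in place of 1/4 in the exponent. Indices
  -- outside `S` may be dropped since their terms only help.
  refine (sq_le_sq₀ (norm_nonneg _) (Real.exp_pos _).le).1 (hb.trans ?_)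
  rw [← Fin.prod_univ_eq_prod_range (fun j => 1 - (1 - lam) * Real.sin (θ j) ^ 2 / 4)]
  simp only [hθi]
  have hnn : ∀ i, 0 ≤ (1 - lam) * Real.sin (t * a i) ^ 2 / 4 := fun i =>
    div_nonneg (mul_nonneg (sub_nonneg.2 h1) (sq_nonneg _)) (by norm_num)
  have h0 : 0 ≤ lam := hlam ▸ l2OpNorm_nonneg _
  calc ∏ i, (1 - (1 - lam) * Real.sin (t * a i) ^ 2 / 4)
      ≤ ∏ i, Real.exp (-((1 - lam) * Real.sin (t * a i) ^ 2 / 4)) := by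
        refine Finset.prod_le_prod (fun i _ => ?_) fun i _ => Real.one_sub_le_exp_neg _
        nlinarith [Real.sin_sq_le_one (t * a i), sq_nonneg (Real.sin (t * a i))]
    _ = Real.exp (-∑ i, (1 - lam) * Real.sin (t * a i) ^ 2 / 4) := by
        rw [← Real.exp_sum, Finset.sum_neg_distrib]
    _ ≤ Real.exp (-∑ i ∈ S, (1 - lam) * Real.sin (t * a i) ^ 2 / 4) := by
        refine Real.exp_le_exp.2 (neg_le_neg ?_)
        exact Finset.sum_le_univ_sum_of_nonneg hnn
    _ = _ := by
        rw [← Real.exp_nat_mul]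
        congr 1
        rw [← Finset.sum_div, ← Finset.mul_sum]
        push_cast
        ring

end IsStationaryReversibleChain

/-! ### Esseen's inequality with a Fejér kernel -/

/-- The Fourier transform of `1 - t` on `[0, 1]`. -/
theorem integral_one_sub_mul_cos {x : ℝ} (hx : x ≠ 0) :
    ∫ t in (0 : ℝ)..1, (1 - t) * Real.cos (t * x) = (1 - Real.cos x) / x ^ 2 := by
  have hd : ∀ t ∈ Set.uIcc (0 : ℝ) 1,
      HasDerivAt (fun t => (1 - t) * Real.sin (t * x) / x - Real.cos (t * x) / x ^ 2)
        ((1 - t) * Real.cos (t * x)) t := by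
    intro t _
    have h1 : HasDerivAt (fun t : ℝ => t * x) x t := by
      simpa using (hasDerivAt_id t).mul_const x
    have h2 := (((hasDerivAt_id t).const_sub 1).mul h1.sin).div_const x
    have h3 := h1.cos.div_const (x ^ 2)
    refine (h2.sub h3).congr_deriv ?_
    simp only [id]
    field_simp
    ring
  rw [intervalIntegral.integral_eq_sub_of_hasDerivAt hd
    (Continuous.intervalIntegrable (by fun_prop) _ _)]
  simp
  ring

theorem integral_one_sub_mul_cos_nonneg (x : ℝ) :
    0 ≤ ∫ t in (0 : ℝ)..1, (1 - t) * Real.cos (t * x) := by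
  rcases eq_or_ne x 0 with rfl | hx
  · refine intervalIntegral.integral_nonneg zero_le_one fun t ht => ?_
    simpa using ht.2
  · rw [integral_one_sub_mul_cos hx]
    exact div_nonneg (sub_nonneg.2 (Real.cos_le_one x)) (sq_nonneg x)

/-- On this range the cosine is at least 1/2. Together with nonnegativity everywhere, four times the
kernel majorises the indicator of `[-1, 1]`. -/
theorem one_le_integral_one_sub_mul_cos {x : ℝ} (hx : |x| ≤ 1) :
    1 ≤ 4 * ∫ t in (0 : ℝ)..1, (1 - t) * Real.cos (t * x) := by
  have h : ∫ t in (0 : ℝ)..1, (1 - t) * (1 / 2) ≤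
      ∫ t in (0 : ℝ)..1, (1 - t) * Real.cos (t * x) := by
    refine intervalIntegral.integral_mono_on zero_le_one
      (Continuous.intervalIntegrable (by fun_prop) _ _)
      (Continuous.intervalIntegrable (by fun_prop) _ _) fun t ht => ?_
    refine mul_le_mul_of_nonneg_left ?_ (sub_nonneg.2 ht.2)
    have h1 := Real.one_sub_sq_div_two_le_cos (x := t * x)
    have h2 : (t * x) ^ 2 ≤ 1 := by
      rw [sq_le_one_iff_abs_le_one, abs_mul, abs_of_nonneg ht.1]
      exact mul_le_one₀ ht.2 (abs_nonneg x) hx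
    linarith
  have e : ∫ t in (0 : ℝ)..1, (1 - t) * (1 / 2) = 1 / 4 := by
    rw [intervalIntegral.integral_mul_const, intervalIntegral.integral_sub
      (by simp) (by simp)]
    simp
    norm_num
  linarith

/-- Esseen's concentration inequality, in a form convenient for explicit bounds. -/
theorem measureReal_abs_le_one_le_integral {Ω : Type*} [MeasurableSpace Ω] (P : Measure Ω)
    [IsProbabilityMeasure P] (X : Ω → ℝ) (hX : Measurable X) (G : ℝ → ℝ) (hG : Continuous G)
    (hφ : ∀ t, ‖∫ ω, Complex.exp (↑(t * X ω) * Complex.I) ∂P‖ ≤ G t) :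
    P.real {ω | |X ω| ≤ 1} ≤ 4 * ∫ t in (0 : ℝ)..1, G t := by
  have hcos : ∀ t, ∫ ω, Real.cos (t * X ω) ∂P ≤ G t := by
    intro t
    have hint : Integrable (fun ω => Complex.exp (↑(t * X ω) * Complex.I)) P := by
      refine Integrable.of_bound (C := 1) (by fun_prop) (Filter.Eventually.of_forall fun ω => ?_)
      rw [Complex.norm_exp_ofReal_mul_I]
    have : ∫ ω, Real.cos (t * X ω) ∂P = (∫ ω, Complex.exp (↑(t * X ω) * Complex.I) ∂P).re := by
      rw [← RCLike.re_eq_complex_re, ← integral_re hint]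
      simp only [RCLike.re_eq_complex_re, Complex.exp_ofReal_mul_I_re]
    rw [this]
    exact ((Complex.re_le_norm _).trans (hφ t))
  set ν : Measure ℝ := volume.restrict (Set.Ioc 0 1)
  have hI : Integrable (fun p : Ω × ℝ => (1 - p.2) * Real.cos (p.2 * X p.1)) (P.prod ν) := by
    refine Integrable.of_bound (C := 1) ?_ ?_
    · exact (Measurable.aestronglyMeasurable (by fun_prop))
    · have : ∀ᵐ p ∂(P.prod ν), p.2 ∈ Set.Ioc (0 : ℝ) 1 :=
        Measure.quasiMeasurePreserving_snd.ae (ae_restrict_mem measurableSet_Ioc)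
      filter_upwards [this] with p hp
      rw [norm_mul, Real.norm_eq_abs, Real.norm_eq_abs]
      refine mul_le_one₀ ?_ (abs_nonneg _) (Real.abs_cos_le_one _)
      rw [abs_le]; constructor <;> linarith [hp.1, hp.2]
  have hk : ∀ x, ∫ t in (0 : ℝ)..1, (1 - t) * Real.cos (t * x) =
      ∫ t, (1 - t) * Real.cos (t * x) ∂ν := fun x =>
    intervalIntegral.integral_of_le zero_le_one
  have hswap := integral_integral_swap (f := fun ω t => (1 - t) * Real.cos (t * X ω)) hI
  have hmeas : MeasurableSet {ω | |X ω| ≤ 1} := measurableSet_le (by fun_prop) (by fun_prop)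
  have hG0 : ∀ t, 0 ≤ G t := fun t => (norm_nonneg _).trans (hφ t)
  calc P.real {ω | |X ω| ≤ 1} = ∫ ω, Set.indicator {ω | |X ω| ≤ 1} 1 ω ∂P := by
        rw [integral_indicator_one hmeas]
    _ ≤ ∫ ω, 4 * ∫ t, (1 - t) * Real.cos (t * X ω) ∂ν ∂P := by
        refine integral_mono ((integrable_const (1 : ℝ)).indicator hmeas)
          (hI.integral_prod_left.const_mul 4) fun ω => ?_
        simp only [← hk]
        by_cases hω : ω ∈ {ω | |X ω| ≤ 1}
        · rw [Set.indicator_of_mem hω]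
          exact one_le_integral_one_sub_mul_cos hω
        · rw [Set.indicator_of_notMem hω]
          exact mul_nonneg (by norm_num) (integral_one_sub_mul_cos_nonneg _)
    _ = 4 * ∫ t, ∫ ω, (1 - t) * Real.cos (t * X ω) ∂P ∂ν := by
        rw [integral_const_mul, hswap]
    _ ≤ 4 * ∫ t, G t ∂ν := by
        refine mul_le_mul_of_nonneg_left ?_ (by norm_num)
        refine integral_mono_ae hI.integral_prod_right
          (hG.integrableOn_Ioc) ?_
        filter_upwards [ae_restrict_mem measurableSet_Ioc] with t ht
        rw [integral_const_mul]
        have h1 := mul_le_mul_of_nonneg_left (hcos t) (sub_nonneg.2 ht.2)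
        have h2 := hG0 t
        nlinarith [ht.1]
    _ = 4 * ∫ t in (0 : ℝ)..1, G t := by
        rw [intervalIntegral.integral_of_le zero_le_one]

/-! ### Integrals of `exp(-K sin²)` -/

theorem integral_exp_neg_mul_sin_sq_le {K : ℝ} (hK : 0 < K) :
    ∫ y in (0 : ℝ)..Real.pi, Real.exp (-K * Real.sin y ^ 2) ≤ 3 / √K := by
  have hper : Function.Periodic (fun y => Real.exp (-K * Real.sin y ^ 2)) Real.pi := fun y => by
    simp
  have h1 := hper.intervalIntegral_add_eq 0 (-(Real.pi / 2))
  rw [zero_add, show -(Real.pi / 2) + Real.pi = Real.pi / 2 by ring] at h1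
  rw [h1]
  -- Jordan's inequality `|sin y| ≥ 2|y|/π` on the period centred at 0 gives a Gaussian with this
  -- parameter; the constant 3 then amounts to `π³ ≤ 36`.
  set c := K * (2 / Real.pi) ^ 2 with hc
  have hπ := Real.pi_pos
  have hcpos : 0 < c := by positivity
  have hgi := integrable_exp_neg_mul_sq hcpos
  calc ∫ y in (-(Real.pi / 2))..(Real.pi / 2), Real.exp (-K * Real.sin y ^ 2)
      ≤ ∫ y in (-(Real.pi / 2))..(Real.pi / 2), Real.exp (-c * y ^ 2) := by
        refine intervalIntegral.integral_mono_on (by linarith)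
          (Continuous.intervalIntegrable (by fun_prop) _ _)
          (Continuous.intervalIntegrable (by fun_prop) _ _) fun y hy => ?_
        have := Real.mul_abs_le_abs_sin (abs_le.2 ⟨hy.1, hy.2⟩)
        have h2 := pow_le_pow_left₀ (by positivity) this 2
        rw [mul_pow, sq_abs, sq_abs] at h2
        refine Real.exp_le_exp.2 ?_
        rw [hc]
        nlinarith
    _ ≤ ∫ y, Real.exp (-c * y ^ 2) := by
        rw [intervalIntegral.integral_of_le (by linarith)]
        exact setIntegral_le_integral hgi (Filter.Eventually.of_forall fun y => (Real.exp_pos _).le)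
    _ = √(Real.pi / c) := integral_gaussian c
    _ ≤ 3 / √K := by
        refine Real.sqrt_le_iff.2 ⟨by positivity, ?_⟩
        rw [div_pow, Real.sq_sqrt hK.le, hc, div_le_div_iff₀ (by positivity) hK, div_pow]
        have h3 : Real.pi ^ 3 ≤ 36 := by
          have := Real.pi_lt_d2
          calc Real.pi ^ 3 ≤ 3.15 ^ 3 := by gcongr
            _ ≤ 36 := by norm_num
        field_simp
        nlinarith

/-- After substituting `y = t * s`, the interval is covered by at most `|s| + 1` periods, each
contributing at most `3 / √K`. -/
theorem integral_exp_neg_mul_sin_sq_scaled_le {K s : ℝ} (hK : 0 < K) (hs : s ≠ 0) :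
    ∫ t in (0 : ℝ)..1, Real.exp (-K * Real.sin (t * s) ^ 2) ≤ (1 + 1 / |s|) * (3 / √K) := by
  wlog hpos : 0 < s generalizing s
  · have := this (neg_ne_zero.2 hs) (by
      rcases lt_or_gt_of_ne hs with h | h
      · linarith
      · exact absurd h hpos)
    simpa using this
  rw [abs_of_pos hpos]
  have hcont : Continuous fun y => Real.exp (-K * Real.sin y ^ 2) := by fun_prop
  have hπ := Real.pi_pos
  have hper : Function.Periodic (fun y => Real.exp (-K * Real.sin y ^ 2)) Real.pi := fun y => by
    simp
  rw [intervalIntegral.integral_comp_mul_right (fun y => Real.exp (-K * Real.sin y ^ 2)) hs]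
  set M := ⌈s / Real.pi⌉₊
  have hM : s ≤ M * Real.pi := (div_le_iff₀ hπ).1 (Nat.le_ceil _)
  have hM2 : (M : ℝ) ≤ s + 1 := by
    refine (Nat.ceil_lt_add_one (by positivity)).le.trans ?_
    gcongr
    exact div_le_self hpos.le (by linarith [Real.pi_gt_three])
  have h1 : ∫ y in (0 : ℝ)..s, Real.exp (-K * Real.sin y ^ 2) ≤
      ∫ y in (0 : ℝ)..(M * Real.pi), Real.exp (-K * Real.sin y ^ 2) := by
    refine intervalIntegral.integral_mono_interval le_rfl hpos.le hM
      (Filter.Eventually.of_forall fun y => (Real.exp_pos _).le) (hcont.intervalIntegrable _ _)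
  have h2 := hper.intervalIntegral_add_zsmul_eq (M : ℤ) 0 hcont.intervalIntegrable
  simp only [zero_add, zsmul_eq_mul, Int.cast_natCast] at h2
  rw [h2] at h1
  have h3 := integral_exp_neg_mul_sin_sq_le hK
  rw [zero_mul, one_mul, smul_eq_mul]
  calc s⁻¹ * ∫ y in (0 : ℝ)..s, Real.exp (-K * Real.sin y ^ 2)
      ≤ s⁻¹ * ((s + 1) * (3 / √K)) := by
        refine mul_le_mul_of_nonneg_left (h1.trans ?_) (by positivity)
        exact mul_le_mul hM2 h3
          (intervalIntegral.integral_nonneg hπ.le fun y _ => (Real.exp_pos _).le) (by positivity)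
    _ = _ := by field_simp

/-- Jensen's inequality for the exponential. -/
theorem exp_neg_sum_le_average {ι : Type*} (S : Finset ι) (hS : S.Nonempty) (κ : ℝ) (x : ι → ℝ) :
    Real.exp (-κ * ∑ i ∈ S, x i) ≤
      (S.card : ℝ)⁻¹ * ∑ i ∈ S, Real.exp (-(κ * S.card) * x i) := by
  have hc : (S.card : ℝ) ≠ 0 := Nat.cast_ne_zero.2 hS.card_ne_zero
  have := convexOn_exp.map_sum_le (t := S) (w := fun _ => (S.card : ℝ)⁻¹)
    (p := fun i => -(κ * S.card) * x i) (fun _ _ => by positivity) (by simp [hc])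
    (fun _ _ => Set.mem_univ _)
  simp only [smul_eq_mul, ← Finset.mul_sum] at this
  refine le_trans (le_of_eq ?_) this
  congr 1
  field_simp

/-! ### Rademacher sums and the choice of a sign vector -/

/-- The sign `±1` encoded by a Boolean. -/
def boolSign (b : Bool) : ℝ := if b then 1 else -1

theorem sum_cons_bool {d : ℕ} (F : (Fin (d + 1) → Bool) → ℝ) :
    ∑ ε, F ε = ∑ ε : Fin d → Bool, (F (Fin.cons true ε) + F (Fin.cons false ε)) := by
  rw [← (Fin.consEquiv fun _ : Fin (d + 1) => Bool).sum_comp, Fintype.sum_prod_type,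
    Fintype.sum_bool, ← Finset.sum_add_distrib]
  rfl

theorem rademacher_second_moment {d : ℕ} (x : Fin d → ℝ) :
    ∑ ε : Fin d → Bool, (∑ k, boolSign (ε k) * x k) ^ 2 = 2 ^ d * ∑ k, x k ^ 2 := by
  induction d with
  | zero => simp
  | succ d ih =>
    rw [sum_cons_bool]
    simp only [Fin.sum_univ_succ, Fin.cons_zero, Fin.cons_succ]
    set y := fun k : Fin d => x k.succ
    have e : ∀ ε : Fin d → Bool,
        (boolSign true * x 0 + ∑ k, boolSign (ε k) * x k.succ) ^ 2 +
          (boolSign false * x 0 + ∑ k, boolSign (ε k) * x k.succ) ^ 2 =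
        2 * (∑ k, boolSign (ε k) * y k) ^ 2 + 2 * x 0 ^ 2 := fun ε => by
      simp only [boolSign, if_true, Bool.false_eq_true, if_false, y]; ring
    rw [Finset.sum_congr rfl fun ε _ => e ε, Finset.sum_add_distrib, ← Finset.mul_sum, ih]
    simp [y]
    ring

theorem rademacher_fourth_moment_le {d : ℕ} (x : Fin d → ℝ) :
    ∑ ε : Fin d → Bool, (∑ k, boolSign (ε k) * x k) ^ 4 ≤ 3 * 2 ^ d * (∑ k, x k ^ 2) ^ 2 := by
  induction d with
  | zero => simp
  | succ d ih =>
    rw [sum_cons_bool]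
    simp only [Fin.sum_univ_succ, Fin.cons_zero, Fin.cons_succ]
    set y := fun k : Fin d => x k.succ
    have e : ∀ ε : Fin d → Bool,
        (boolSign true * x 0 + ∑ k, boolSign (ε k) * x k.succ) ^ 4 +
          (boolSign false * x 0 + ∑ k, boolSign (ε k) * x k.succ) ^ 4 =
        2 * (∑ k, boolSign (ε k) * y k) ^ 4 +
          12 * x 0 ^ 2 * (∑ k, boolSign (ε k) * y k) ^ 2 + 2 * x 0 ^ 4 := fun ε => by
      simp only [boolSign, if_true, Bool.false_eq_true, if_false, y]; ring
    rw [Finset.sum_congr rfl fun ε _ => e ε, Finset.sum_add_distrib, Finset.sum_add_distrib,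
      ← Finset.mul_sum, ← Finset.mul_sum, rademacher_second_moment]
    have h := ih y
    -- With the constant 3 the other terms balance exactly; the slack is a multiple of this one.
    have hp : (0 : ℝ) ≤ 2 ^ d * x 0 ^ 4 := by positivity
    simp only [Finset.sum_const, Finset.card_univ, Fintype.card_fun, Fintype.card_bool,
      Fintype.card_fin, nsmul_eq_mul, Nat.cast_pow, Nat.cast_ofNat]
    change _ ≤ 3 * 2 ^ (d + 1) * (x 0 ^ 2 + ∑ k, y k ^ 2) ^ 2
    rw [pow_succ (2 : ℝ)]
    nlinarith

/-- Paley–Zygmund for Rademacher sums. -/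
theorem rademacher_anticoncentration {d : ℕ} (x : Fin d → ℝ) (hx : 1 ≤ ∑ k, x k ^ 2) :
    (2 : ℝ) ^ d / 16 ≤
      ∑ ε : Fin d → Bool, if 1 ≤ 2 * (∑ k, boolSign (ε k) * x k) ^ 2 then (1 : ℝ) else 0 := by
  set q := ∑ k, x k ^ 2 with hq
  -- A quadratic in `z ^ 2` below a multiple of the indicator: its maximum, at `z ^ 2 = 13 q / 4`,
  -- is `121 q² / 16 ≤ 8 q²`. By the moment bounds its average is at least `13 q² / 2 - 3 q² - 3 q²
  -- = q² / 2`, whence 1/16.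
  have hpt : ∀ z : ℝ, (z ^ 2 - q / 2) * (6 * q - z ^ 2) ≤
      8 * q ^ 2 * if 1 ≤ 2 * z ^ 2 then (1 : ℝ) else 0 := by
    intro z
    split_ifs with h
    · nlinarith [sq_nonneg (z ^ 2 - 13 / 4 * q)]
    · rw [mul_zero]
      push Not at h
      exact mul_nonpos_of_nonpos_of_nonneg (by linarith) (by nlinarith)
  have hs := Finset.sum_le_sum fun (ε : Fin d → Bool) (_ : ε ∈ Finset.univ) =>
    hpt (∑ k, boolSign (ε k) * x k)
  rw [← Finset.mul_sum] at hs
  have e : ∀ z : ℝ, (z ^ 2 - q / 2) * (6 * q - z ^ 2) = 13 / 2 * q * z ^ 2 - z ^ 4 - 3 * q ^ 2 :=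
    fun z => by ring
  simp only [e, Finset.sum_sub_distrib, ← Finset.mul_sum, rademacher_second_moment, ← hq,
    Finset.sum_const, Finset.card_univ, Fintype.card_fun, Fintype.card_bool,
    Fintype.card_fin, nsmul_eq_mul, Nat.cast_pow, Nat.cast_ofNat] at hs
  have h4 := rademacher_fourth_moment_le x
  rw [← hq] at h4
  have hq2 : 0 < 8 * q ^ 2 := by positivity
  refine le_of_mul_le_mul_left ?_ hq2
  linarith

/-- Some sign vector has a large inner product with a positive proportion of given long vectors. -/
theorem exists_sign_vector {d n : ℕ} (x : Fin n → Fin d → ℝ) (hx : ∀ i, 1 ≤ ∑ k, x i k ^ 2) :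
    ∃ ε : Fin d → Bool, (n : ℝ) / 16 ≤
      ({i | 1 ≤ 2 * (∑ k, boolSign (ε k) * x i k) ^ 2} : Finset (Fin n)).card := by
  by_contra! hcon
  have h1 := Finset.sum_le_sum fun (i : Fin n) (_ : i ∈ Finset.univ) =>
    rademacher_anticoncentration (x i) (hx i)
  -- Double counting of pairs (index, sign vector).
  rw [Finset.sum_comm] at h1
  have h2 := Finset.sum_lt_sum_of_nonempty (s := (Finset.univ : Finset (Fin d → Bool)))
    Finset.univ_nonempty fun ε _ => hcon ε
  simp only [Finset.card_filter, Nat.cast_sum, Nat.cast_ite, Nat.cast_one, Nat.cast_zero] at h2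
  have h3 := h1.trans_lt h2
  simp only [Finset.sum_const, Finset.card_univ, Fintype.card_fun, Fintype.card_bool,
    Fintype.card_fin, nsmul_eq_mul, Nat.cast_pow, Nat.cast_ofNat] at h3
  linarith

/-! ### The one-dimensional inequality -/

namespace IsStationaryReversibleChain

/-- One-dimensional Littlewood–Offord inequality along a reversible chain, when only the
coefficients indexed by `S` are known to be large. -/
theorem measureReal_abs_sum_sub_le {Ω : Type*} [MeasurableSpace Ω] {P : Measure Ω}
    [IsProbabilityMeasure P] {N n : ℕ} {A : Matrix (Fin N) (Fin N) ℝ} {μ : Fin N → ℝ}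
    {Y : ℕ → Ω → Fin N} (H : IsStationaryReversibleChain P A μ Y) {lam : ℝ}
    (hlam : lam = l2OpNorm μ (A - averagingOp μ)) (h1 : lam < 1) (f : Fin n → Fin N → ℝ)
    (hf : ∀ i y, f i y = -1 ∨ f i y = 1) (hf0 : ∀ i, ∫ ω, f i (Y i ω) ∂P = 0)
    (a : Fin n → ℝ) (c : ℝ) {S : Finset (Fin n)} (hS : S.Nonempty) {δ r : ℝ} (hδ : 0 < δ)
    (hr : 0 < r) (ha : ∀ i ∈ S, δ ≤ |a i|) :
    P.real {ω | |∑ i, f i (Y i ω) * a i - c| ≤ r} ≤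
      4 * ((1 + r / δ) * (3 / √((1 - lam) / 8 * S.card))) := by
  have hcard : (0 : ℝ) < S.card := Nat.cast_pos.2 hS.card_pos
  set K := (1 - lam) / 8 * S.card with hKdef
  have hK : 0 < K := mul_pos (by linarith) hcard
  set G : ℝ → ℝ := fun t =>
    (S.card : ℝ)⁻¹ * ∑ i ∈ S, Real.exp (-K * Real.sin (t * (a i / r)) ^ 2) with hG
  have hcont : Continuous G := by fun_prop
  set X : Ω → ℝ := fun ω => ∑ i, f i (Y i ω) * (a i / r) - c / r with hX
  have hXm : Measurable X := by
    refine (Finset.measurable_sum _ fun i _ => ?_).sub_const _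
    exact ((measurable_of_finite (f i)).comp (H.measurable i)).mul_const _
  have hset : {ω | |∑ i, f i (Y i ω) * a i - c| ≤ r} = {ω | |X ω| ≤ 1} := by
    ext ω
    have : X ω = (∑ i, f i (Y i ω) * a i - c) / r := by
      simp only [hX, sub_div, Finset.sum_div, mul_div_assoc]
    simp only [Set.mem_ofPred_eq, this, abs_div, abs_of_pos hr, div_le_one hr]
  rw [hset]
  refine (measureReal_abs_le_one_le_integral P X hXm G hcont fun t => ?_).trans ?_
  · refine (H.norm_charFun_le hlam h1.le f hf hf0 (fun i => a i / r) (c / r) S t).trans ?_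
    -- Jensen replaces the sum of frequencies by an average of single-frequency exponentials, each
    -- with the full rate `K`.
    exact exp_neg_sum_le_average S hS _ _
  · refine mul_le_mul_of_nonneg_left ?_ (by norm_num)
    rw [hG, intervalIntegral.integral_const_mul, intervalIntegral.integral_finsetSum
      fun i _ => Continuous.intervalIntegrable (by fun_prop) _ _, inv_mul_le_iff₀ hcard,
      ← nsmul_eq_mul]
    refine Finset.sum_le_card_nsmul _ _ _ fun i hi => ?_
    have hai : 0 < |a i| := hδ.trans_le (ha i hi)
    refine (integral_exp_neg_mul_sin_sq_scaled_le hK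
      (div_ne_zero (abs_pos.1 hai) hr.ne')).trans ?_
    refine mul_le_mul_of_nonneg_right ?_ (by positivity)
    rw [abs_div, abs_of_pos hr, one_div_div]
    gcongr
    exact ha i hi

end IsStationaryReversibleChain

/-! ### Reduction to dimension one -/

theorem abs_sum_boolSign_mul_le {d : ℕ} (ε : Fin d → Bool) (x : EuclideanSpace ℝ (Fin d)) :
    |∑ k, boolSign (ε k) * x k| ≤ √d * ‖x‖ := by
  refine abs_le_of_sq_le_sq ?_ (by positivity)
  rw [mul_pow, Real.sq_sqrt (Nat.cast_nonneg d), EuclideanSpace.real_norm_sq_eq]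
  refine (Finset.sum_mul_sq_le_sq_mul_sq _ _ _).trans (le_of_eq ?_)
  have : ∀ b, boolSign b ^ 2 = 1 := by intro b; cases b <;> simp [boolSign]
  simp [this]

theorem theorem1 (C' : ℝ) (hC' : 0 < C') :
    ∃ C : ℝ, 0 < C ∧
      ∀ (Ω : Type*) [MeasurableSpace Ω] (P : Measure Ω) [IsProbabilityMeasure P]
        (N n d : ℕ) (_ : 1 ≤ n)
        (A : Matrix (Fin N) (Fin N) ℝ) (μ : Fin N → ℝ) (Y : ℕ → Ω → Fin N)
        (_ : IsStationaryReversibleChain P A μ Y)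
        (lam : ℝ) (_ : lam = l2OpNorm μ (A - averagingOp μ)) (_ : lam < 1)
        (f : Fin n → Fin N → ℝ) (_ : ∀ i y, f i y = -1 ∨ f i y = 1)
        (_ : ∀ i, ∫ ω, f i (Y i ω) ∂P = 0)
        (x₀ : EuclideanSpace ℝ (Fin d)) (R : ℝ) (_ : 1 / (C' * √d) ≤ R)
        (v : Fin n → EuclideanSpace ℝ (Fin d)) (_ : ∀ i, 1 ≤ ‖v i‖),
        P.real {ω | ‖(∑ i, f i (Y i ω) • v i) - x₀‖ ≤ R} ≤
          C * R * √d / ((1 - lam) * √n) := by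
  -- 144 = 4 · 3 · 12, with 4 from Esseen, 3 from the Gaussian integral and 12 from `hsqrt`; `C' +
  -- 2` bounds `(1 + 2 * r) / r`.
  refine ⟨144 * (C' + 2), by positivity, ?_⟩
  intro Ω _ P _ N n d hn A μ Y H lam hlam h1 f hf hf0 x₀ R hR v hv
  have hd : 0 < d := by
    rcases Nat.eq_zero_or_pos d with rfl | h
    · have := hv ⟨0, hn⟩
      rw [Subsingleton.elim (v ⟨0, hn⟩) 0, norm_zero] at this
      linarith
    · exact h
  have hsd : 0 < √(d : ℝ) := Real.sqrt_pos.2 (Nat.cast_pos.2 hd)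
  have hRpos : 0 < R := lt_of_lt_of_le (by positivity) hR
  set r := √d * R with hr
  have hrpos : 0 < r := by positivity
  -- The only use of the lower bound on `R` beyond positivity: it absorbs the additive 1 in the
  -- one-dimensional estimate.
  have hCr : 1 ≤ C' * r := by
    rw [div_le_iff₀ (by positivity)] at hR
    rw [hr]; linarith
  obtain ⟨ε, hε⟩ := exists_sign_vector (fun i => (v i).ofLp) fun i => by
    rw [← EuclideanSpace.real_norm_sq_eq]
    exact one_le_pow₀ (hv i)
  set a : Fin n → ℝ := fun i => ∑ k, boolSign (ε k) * v i k with ha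
  set S : Finset (Fin n) := {i | 1 ≤ 2 * a i ^ 2} with hS
  change (n : ℝ) / 16 ≤ S.card at hε
  have hnpos : (0 : ℝ) < n := Nat.cast_pos.2 hn
  have hSne : S.Nonempty := by
    rw [← Finset.card_pos, ← Nat.cast_pos (α := ℝ)]
    linarith
  have haS : ∀ i ∈ S, 1 / 2 ≤ |a i| := by
    intro i hi
    rw [hS, Finset.mem_filter_univ] at hi
    refine abs_le_of_sq_le_sq' ?_ (abs_nonneg _) |>.2
    rw [sq_abs]
    linarith
  have hmono : P.real {ω | ‖(∑ i, f i (Y i ω) • v i) - x₀‖ ≤ R} ≤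
      P.real {ω | |∑ i, f i (Y i ω) * a i - ∑ k, boolSign (ε k) * x₀ k| ≤ r} := by
    refine measureReal_mono fun ω hω => ?_
    have h := abs_sum_boolSign_mul_le ε ((∑ i, f i (Y i ω) • v i) - x₀)
    have e : ∑ k, boolSign (ε k) * ((∑ i, f i (Y i ω) • v i) - x₀) k =
        ∑ i, f i (Y i ω) * a i - ∑ k, boolSign (ε k) * x₀ k := by
      simp only [PiLp.sub_apply, WithLp.ofLp_sum, WithLp.ofLp_smul, Finset.sum_apply,
        Pi.smul_apply, smul_eq_mul, mul_sub, Finset.sum_sub_distrib, Finset.mul_sum, ha]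
      rw [Finset.sum_comm]
      congr 1
      exact Finset.sum_congr rfl fun i _ => Finset.sum_congr rfl fun k _ => by ring
    rw [e] at h
    exact h.trans (mul_le_mul_of_nonneg_left hω hsd.le)
  refine hmono.trans ((H.measureReal_abs_sum_sub_le hlam h1 f hf hf0 a _ hSne
    (by norm_num : (0 : ℝ) < 1 / 2) hrpos haS).trans ?_)
  have h0 : 0 ≤ lam := hlam ▸ l2OpNorm_nonneg _
  have h1' : 0 < 1 - lam := by linarith
  -- Since `S.card ≥ n / 16`, the radicand is at least `(1 - lam) * n / 128`, and 128 ≤ 12².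
  -- Replacing `1 - lam` by its square, allowed as `0 ≤ lam`, gives up a factor `√(1 - lam)`.
  have hsqrt : (1 - lam) * √n / 12 ≤ √((1 - lam) / 8 * S.card) := by
    refine Real.le_sqrt_of_sq_le ?_
    rw [div_pow, mul_pow, Real.sq_sqrt hnpos.le]
    have h2 : (1 - lam) ^ 2 * n ≤ (1 - lam) * n :=
      mul_le_mul_of_nonneg_right (by nlinarith) hnpos.le
    have h3 : (1 - lam) * (n / 16) ≤ (1 - lam) * S.card :=
      mul_le_mul_of_nonneg_left hε h1'.le
    have h4 : 0 ≤ (1 - lam) * n := mul_nonneg h1'.le hnpos.le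
    linarith
  have hsn : 0 < √(n : ℝ) := Real.sqrt_pos.2 hnpos
  calc 4 * ((1 + r / (1 / 2)) * (3 / √((1 - lam) / 8 * S.card)))
      ≤ 4 * ((C' * r + r / (1 / 2)) * (3 / ((1 - lam) * √n / 12))) := by gcongr
    _ = 144 * (C' + 2) * R * √d / ((1 - lam) * √n) := by
        rw [hr]
        field_simp
        ring
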